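/- For $z$ in the upper half plane $\mathbb{H}$ put $q=e^{2\pi i z}$ and let $\varphi(z)=\sum_{n=-\infty}^{\infty} q^{n^2}$ be Ramanujan's theta function. For a quadratic discriminant $t$ let $\chi_t(n)=\left(\frac{t}{n}\right)$ be the Kronecker symbol. Let $M_3(\Gamma_0(24),\chi)$ denote the space of modular forms of weight $3$ for $\Gamma_0(24)$ with multiplier $\chi$, i.e. of the holomorphic functions $f$ on $\mathbb{H}$, holomorphic at all cusps, with $f\left(\frac{az+b}{cz+d}\right)=\chi(d)(cz+d)^3f(z)$ for all $\begin{pmatrix}a&b\\c&d\end{pmatrix}\in\Gamma_0(24)$. Let $l_1,l_2,l_3,l_6$ be non-negative integers with $l_1+l_2+l_3+l_6=6$. Then $$\prod_{d\mid 6}\varphi^{l_d}(dz)\in\begin{cases} M_3(\Gamma_0(24),\chi_{-4}) & \text{if } l_1+l_3\equiv 0 \pmod 2 \text{ and } l_3+l_6\equiv 0 \pmod 2,\\ M_3(\Gamma_0(24),\chi_{-3}) & \text{if } l_1+l_3\equiv 0 \pmod 2 \text{ and } l_3+l_6\equiv 1 \pmod 2,\\ M_3(\Gamma_0(24),\chi_{-8})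 & \text{if } l_1+l_3\equiv 1 \pmod 2 \text{ and } l_3+l_6\equiv 0 \pmod 2,\\ M_3(\Gamma_0(24),\chi_{-24}) & \text{if } l_1+l_3\equiv 1 \pmod 2 \text{ and } l_3+l_6\equiv 1 \pmod 2. \end{cases}$$ -/

import Mathlib

open UpperHalfPlane
open scoped MatrixGroups ModularForm Manifold

/-- The Kronecker symbol `(a / n)` for integers `a`, `n`: completely multiplicative in `n ≠ 0`, with
`(a / -1) = -1` if `a < 0` and `1` otherwise, `(a / 2)` equal to `0` for even `a`, to `1` for
`a ≡ ±1 (mod 8)` and to `-1` for `a ≡ ±3 (mod 8)`, and `(a / p)` the Legendre symbol for odd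
primes `p` (which is the value of `jacobiSym` at a prime). Moreover `(a / 0) = 1` if `a = ±1`, and
`0` otherwise. -/
def kroneckerSymbol (a n : ℤ) : ℤ :=
  if n = 0 then (if a.natAbs = 1 then 1 else 0)
  else (if n < 0 ∧ a < 0 then -1 else 1) *
    (n.natAbs.primeFactorsList.map fun p : ℕ =>
      if p = 2 then ZMod.χ₈ (a : ZMod 8) else jacobiSym a p).prod

/-- The quadratic character `χ_t(n) = (t / n)`, as a complex-valued function on the integers. -/
noncomputable def kroneckerChar (t : ℤ) : ℤ → ℂ := fun n => (kroneckerSymbol t n : ℂ)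

/-- Modular forms of weight `k` for `Γ₀(N)` with multiplier `χ` (for `N ≥ 1`): holomorphic functions
`f` on the upper half plane with `f ((a z + b) / (c z + d)) = χ(d) (c z + d)^k f(z)` for all
`(a, b; c, d)` in `Γ₀(N)`, which are holomorphic at every cusp, that is, all `f ∣[k] γ` with `γ` in
`SL(2, ℤ)` are bounded at `i∞`. A Dirichlet character `χ` is used here as a function on `ℤ`; only
its values at integers `d` prime to `N` matter. -/
def modularFormsWithChar (N : ℕ) (k : ℤ) (χ : ℤ → ℂ) : Submodule ℂ (ℍ → ℂ) where
  carrier := {f | MDiff f ∧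
    (∀ γ : SL(2, ℤ), γ ∈ CongruenceSubgroup.Gamma0 N → f ∣[k] γ = χ (γ 1 1) • f) ∧
    ∀ γ : SL(2, ℤ), IsBoundedAtImInfty (f ∣[k] γ)}
  zero_mem' := by
    refine ⟨mdifferentiable_const, fun γ _ => by simp, fun γ => ?_⟩
    rw [SlashAction.zero_slash]
    exact Filter.const_boundedAtFilter atImInfty (0 : ℂ)
  add_mem' := by
    rintro f g ⟨hf, hf', hf''⟩ ⟨hg, hg', hg''⟩
    refine ⟨hf.add hg, fun γ h => ?_, fun γ => ?_⟩
    · rw [SlashAction.add_slash, hf' γ h, hg' γ h, smul_add]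
    · rw [SlashAction.add_slash]
      exact (hf'' γ).add (hg'' γ)
  smul_mem' := by
    rintro a f ⟨hf, hf', hf''⟩
    refine ⟨hf.const_smul a, fun γ h => ?_, fun γ => ?_⟩
    · rw [ModularForm.SL_smul_slash, hf' γ h, smul_comm]
    · rw [ModularForm.SL_smul_slash]
      exact (hf'' γ).smul a

/-- Ramanujan's theta function `φ(z) = ∑_{n ∈ ℤ} q^{n²}` with `q = e^{2πiz}`
(a convergent series for `z` in the upper half plane). -/
noncomputable def ramanujanPhi (z : ℂ) : ℂ :=
  ∑' n : ℤ, Complex.exp (2 * Real.pi * Complex.I * z) ^ (n ^ 2)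

/-! ### The theta function: periodicity, Fricke involution, growth. -/

section Theta

open Filter Topology

/-! Put `F = ∏ φ(m z) ^ l m`, of weight 3. The group `Γ₀(4)` is generated by `-1`, translations and
Fricke conjugates of translations, so `φ ^ 2` is an eigenfunction of weight 1
(`Gamma0_four_le_slashEigenSubgroup`). Conjugation by `z ↦ m z` makes `F ^ 2` an eigenfunction of
`Γ₀(24)`, and then `F` is one too, because holomorphic functions on `ℍ` have no zero divisors
(`exists_thetaProduct_slash`).

To find the eigenvalue, Dirichlet's theorem and a translation make the lower right entry a prime
`p`. The matrix carries the cusp `0` to `b / p`. Comparing leading terms at these two cusps gives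
the eigenvalue as a product of quadratic Gauss sums modulo `p`, divided by `p ^ 3`. The number of
Gauss sums is 6, which is even, so only their square `(-1 / p) p` matters, and the eigenvalue is the
Jacobi symbol of `-∏ m ^ l m` at `p` (`thetaProduct_slash_eigenvalue_of_prime`). By reciprocity this
depends only on the entry modulo 24 and is the Kronecker symbol of the stated discriminant.

Holomorphy at the cusps follows from `φ(z) = O(1 + y ^ (-1 / 2))`, since the eigenvalues have
absolute value one. -/

lemma ramanujanPhi_eq_jacobiTheta (z : ℂ) : ramanujanPhi z = jacobiTheta (2 * z) := by
  unfold ramanujanPhi jacobiTheta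
  refine tsum_congr fun n => ?_
  rw [← Complex.exp_int_mul]
  congr 1
  push_cast
  ring

lemma ramanujanPhi_add_one (z : ℂ) : ramanujanPhi (z + 1) = ramanujanPhi z := by
  rw [ramanujanPhi_eq_jacobiTheta, ramanujanPhi_eq_jacobiTheta, ← jacobiTheta_two_add (2 * z)]
  congr 1
  ring

lemma ramanujanPhi_add_int (z : ℂ) (n : ℤ) : ramanujanPhi (z + n) = ramanujanPhi z := by
  have h : Function.Periodic ramanujanPhi 1 := ramanujanPhi_add_one
  simpa using h.int_mul n z

/-- The behaviour of Ramanujan's theta function under the Fricke involution `z ↦ -1 / (4 z)`. -/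
lemma ramanujanPhi_fricke {z : ℂ} (hz : 0 < z.im) :
    ramanujanPhi (-1 / (4 * z)) = (-2 * Complex.I * z) ^ (1 / 2 : ℂ) * ramanujanPhi z := by
  have h2 : 0 < (2 * z).im := by simpa using hz
  have h := jacobiTheta_S_smul ⟨2 * z, h2⟩
  rw [UpperHalfPlane.modular_S_smul] at h
  rw [ramanujanPhi_eq_jacobiTheta, ramanujanPhi_eq_jacobiTheta]
  convert h using 2
  · have : z ≠ 0 := by rintro rfl; simp at hz
    field_simp
    norm_num
  · congr 1
    ring

lemma tendsto_ramanujanPhi_im_atTop :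
    Tendsto ramanujanPhi (comap Complex.im atTop) (𝓝 1) := by
  have h1 : Tendsto (fun τ => jacobiTheta τ - 1) (comap Complex.im atTop) (𝓝 0) := by
    refine isBigO_at_im_infty_jacobiTheta_sub_one.trans_tendsto ?_
    refine Real.tendsto_exp_atBot.comp ?_
    exact (tendsto_comap (f := Complex.im)).const_mul_atTop_of_neg (by simpa using Real.pi_pos)
  have h2 : Tendsto (fun z : ℂ => 2 * z) (comap Complex.im atTop) (comap Complex.im atTop) := by
    rw [tendsto_comap_iff]
    have : Complex.im ∘ (fun z : ℂ => 2 * z) = fun z => 2 * z.im := by ext; simp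
    rw [this]
    exact (tendsto_comap (f := Complex.im)).const_mul_atTop two_pos
  have h3 := (h1.comp h2).add_const 1
  simpa [Function.comp_def, ← ramanujanPhi_eq_jacobiTheta] using h3

lemma differentiableAt_ramanujanPhi {z : ℂ} (hz : 0 < z.im) :
    DifferentiableAt ℂ ramanujanPhi z := by
  have h : ramanujanPhi = jacobiTheta ∘ fun z => 2 * z := funext ramanujanPhi_eq_jacobiTheta
  rw [h]
  exact (differentiableAt_jacobiTheta (by simpa using hz)).comp z (by fun_prop)

lemma mdifferentiable_ramanujanPhi_mul {m : ℕ} (hm : 0 < m) :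
    MDiff (fun z : ℍ => ramanujanPhi (m * z)) := by
  rw [UpperHalfPlane.mdifferentiable_iff]
  have h : DifferentiableOn ℂ (fun z : ℂ => ramanujanPhi (m * z)) {z | 0 < z.im} := by
    intro z hz
    have h1 : DifferentiableAt ℂ ramanujanPhi (m * z) :=
      differentiableAt_ramanujanPhi (by simpa using mul_pos (Nat.cast_pos.mpr hm) hz)
    exact (h1.comp z (by fun_prop : DifferentiableAt ℂ (fun z : ℂ => m * z) z)).differentiableWithinAt
  refine h.congr fun z hz => ?_
  simp [UpperHalfPlane.ofComplex_apply_of_im_pos hz]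

lemma hasSum_ramanujanPhi {z : ℂ} (hz : 0 < z.im) :
    HasSum (fun n : ℤ => Complex.exp (2 * Real.pi * Complex.I * n ^ 2 * z)) (ramanujanPhi z) := by
  have h := hasSum_jacobiTheta₂_term 0 (τ := 2 * z) (by simpa using hz)
  rw [← jacobiTheta_eq_jacobiTheta₂, ← ramanujanPhi_eq_jacobiTheta] at h
  refine h.congr_fun fun n => ?_
  rw [jacobiTheta₂_term]
  congr 1
  ring

/-- Triangle inequality: on the imaginary axis the terms of the series are the absolute values of
the terms at `z`. -/
lemma norm_ramanujanPhi_le {z : ℂ} (hz : 0 < z.im) :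
    ‖ramanujanPhi z‖ ≤ ‖ramanujanPhi (Complex.I * z.im)‖ := by
  have h1 := hasSum_ramanujanPhi (z := Complex.I * z.im) (by simpa using hz)
  have h2 : ∀ n : ℤ, Complex.exp (2 * Real.pi * Complex.I * n ^ 2 * (Complex.I * z.im)) =
      ((‖Complex.exp (2 * Real.pi * Complex.I * n ^ 2 * z)‖ : ℝ) : ℂ) := by
    intro n
    have h3 : 2 * Real.pi * Complex.I * n ^ 2 * z =
        ((2 * Real.pi * n ^ 2 : ℝ) : ℂ) * (Complex.I * z) := by push_cast; ring
    rw [Complex.norm_exp, h3, Complex.re_ofReal_mul, Complex.ofReal_exp]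
    congr 1
    simp only [Complex.mul_re, Complex.I_re, Complex.I_im]
    push_cast
    linear_combination (2 * Real.pi * n ^ 2 * z.im : ℂ) * Complex.I_sq
  simp_rw [h2] at h1
  have h4 := Complex.summable_ofReal.mp h1.summable
  have h5 : ramanujanPhi (Complex.I * z.im) =
      ((∑' n : ℤ, ‖Complex.exp (2 * Real.pi * Complex.I * n ^ 2 * z)‖ : ℝ) : ℂ) := by
    rw [Complex.ofReal_tsum, h1.tsum_eq]
  rw [h5, Complex.norm_real, ← (hasSum_ramanujanPhi hz).tsum_eq]
  exact (norm_tsum_le_tsum_norm h4).trans (le_abs_self _)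

/-- Ramanujan's theta function grows at most like `y ^ (-1 / 2)` towards the real line. -/
lemma exists_norm_ramanujanPhi_le :
    ∃ C : ℝ, 0 < C ∧ ∀ z : ℂ, 0 < z.im → ‖ramanujanPhi z‖ ≤ C * (1 + 1 / √z.im) := by
  have hbig : ∃ C : ℝ, 0 < C ∧ ∀ z : ℂ, 1 / 4 ≤ z.im → ‖ramanujanPhi z‖ ≤ C := by
    refine ⟨1 + 2 / (1 - Real.exp (-Real.pi / 2)), ?_, fun z hz => ?_⟩
    · have : Real.exp (-Real.pi / 2) < 1 := by
        rw [Real.exp_lt_one_iff]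
        linarith [Real.pi_pos]
      have : 0 < 1 - Real.exp (-Real.pi / 2) := by linarith
      positivity
    · have h := norm_jacobiTheta_sub_one_le (τ := 2 * z) (by simp; linarith)
      rw [← ramanujanPhi_eq_jacobiTheta] at h
      have h1 : Real.exp (-Real.pi * (2 * z).im) ≤ Real.exp (-Real.pi / 2) := by
        rw [Real.exp_le_exp]
        simp
        nlinarith [Real.pi_pos]
      have h2 : Real.exp (-Real.pi / 2) < 1 := by
        rw [Real.exp_lt_one_iff]
        linarith [Real.pi_pos]
      have h3 : 2 / (1 - Real.exp (-Real.pi * (2 * z).im)) * Real.exp (-Real.pi * (2 * z).im)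
          ≤ 2 / (1 - Real.exp (-Real.pi / 2)) * 1 := by
        have : 0 < 1 - Real.exp (-Real.pi / 2) := by linarith
        gcongr
        linarith
      calc ‖ramanujanPhi z‖ = ‖(ramanujanPhi z - 1) + 1‖ := by ring_nf
        _ ≤ ‖ramanujanPhi z - 1‖ + ‖(1 : ℂ)‖ := norm_add_le _ _
        _ ≤ _ := by rw [norm_one]; linarith
  obtain ⟨C, hC, hb⟩ := hbig
  refine ⟨C, hC, fun z hz => ?_⟩
  have hs : 0 < √z.im := Real.sqrt_pos.mpr hz
  -- Low points are moved to the imaginary axis, where the Fricke involution sends `i y` to `i / (4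
  -- y)`, of height above 1 when `y < 1 / 4`.
  rcases le_or_gt (1 / 4) z.im with h | h
  · refine (hb z h).trans ?_
    have : 0 ≤ C * (1 / √z.im) := by positivity
    linarith
  · refine (norm_ramanujanPhi_le hz).trans ?_
    have hz' : 0 < (Complex.I * (z.im : ℂ)).im := by simpa using hz
    have h1 := ramanujanPhi_fricke hz'
    have h2 : ‖ramanujanPhi (-1 / (4 * (Complex.I * (z.im : ℂ))))‖ ≤ C := by
      apply hb
      have : -1 / (4 * (Complex.I * (z.im : ℂ))) = ((1 / (4 * z.im) : ℝ) : ℂ) * Complex.I := by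
        have : (z.im : ℂ) ≠ 0 := by exact_mod_cast hz.ne'
        push_cast
        field_simp
        simp
      rw [this]
      simp only [Complex.mul_im, Complex.ofReal_re, Complex.I_im, Complex.ofReal_im, Complex.I_re]
      rw [mul_one, mul_zero, add_zero, div_le_div_iff₀ (by norm_num) (by positivity)]
      linarith
    have h3 : -2 * Complex.I * (Complex.I * (z.im : ℂ)) = ((2 * z.im : ℝ) : ℂ) := by
      push_cast
      linear_combination (-2 * (z.im : ℂ)) * Complex.I_sq
    rw [h1, h3, norm_mul, Complex.norm_cpow_eq_rpow_re_of_pos (by positivity)] at h2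
    have h4 : (2 * z.im) ^ ((1 / 2 : ℂ).re) = √(2 * z.im) := by
      rw [Real.sqrt_eq_rpow]
      norm_num
    rw [h4] at h2
    have h5 : √z.im ≤ √(2 * z.im) := Real.sqrt_le_sqrt (by linarith)
    have h6 : ‖ramanujanPhi (Complex.I * z.im)‖ ≤ C / √z.im := by
      rw [le_div_iff₀ hs]
      nlinarith [norm_nonneg (ramanujanPhi (Complex.I * z.im))]
    calc _ ≤ C / √z.im := h6
      _ ≤ _ := by rw [mul_add, mul_one, mul_one_div]; linarith

end Theta

/-! ### Asymptotics of the theta function at a rational cusp. -/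

section CuspAsymptotics

open Filter Topology

/-- The functional equation exchanges `x → 0` with `1 / x → ∞`, where the dual kernel tends to its
constant term 1. -/
lemma tendsto_sqrt_mul_evenKernel (a : UnitAddCircle) :
    Tendsto (fun x : ℝ => √x * HurwitzZeta.evenKernel a x) (𝓝[>] 0) (𝓝 1) := by
  obtain ⟨p, hp, h⟩ := HurwitzZeta.isBigO_atTop_cosKernel_sub a
  have h1 : Tendsto (fun x => HurwitzZeta.cosKernel a x - 1) atTop (𝓝 0) := by
    refine h.trans_tendsto (Real.tendsto_exp_atBot.comp ?_)
    exact tendsto_id.const_mul_atTop_of_neg (by linarith)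
  have h2 : Tendsto (fun x => HurwitzZeta.cosKernel a x) atTop (𝓝 1) := by
    simpa using h1.add_const 1
  refine (h2.comp tendsto_inv_nhdsGT_zero).congr' ?_
  filter_upwards [self_mem_nhdsWithin] with x (hx : 0 < x)
  have : √x ≠ 0 := (Real.sqrt_pos.mpr hx).ne'
  rw [HurwitzZeta.evenKernel_functional_equation, ← Real.sqrt_eq_rpow, ← mul_assoc,
    mul_one_div_cancel this, one_mul, one_div, Function.comp_apply]

/-- Write `n = p k + r`: the phase `a n ^ 2 / p` modulo 1 depends only on `r`, and the sum over `k`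
is a shifted Gaussian sum. -/
lemma ramanujanPhi_rational_add_I_mul (a : ℤ) (p : ℕ) [NeZero p] {ε : ℝ} (hε : 0 < ε) :
    ramanujanPhi (a / p + Complex.I * ε) =
      ∑ r : Fin p, Complex.exp (2 * Real.pi * Complex.I * (a * (r : ℕ) ^ 2 / p)) *
        HurwitzZeta.evenKernel (((r : ℕ) / p : ℝ) : UnitAddCircle) (2 * p ^ 2 * ε) := by
  have hp : (p : ℂ) ≠ 0 := Nat.cast_ne_zero.mpr (NeZero.ne p)
  have hp' : (0 : ℝ) < p := Nat.cast_pos.mpr (NeZero.pos p)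
  have him : 0 < ((a : ℂ) / p + Complex.I * ε).im := by
    have : ((a : ℂ) / p) = (((a : ℝ) / p : ℝ) : ℂ) := by push_cast; rfl
    rw [this]
    simpa using hε
  have h1 := (Int.divModEquiv p).symm.hasSum_iff.mpr (hasSum_ramanujanPhi him)
  have h2 := ((Equiv.prodComm (Fin p) ℤ).hasSum_iff.mpr h1)
  refine (h2.prod_fiberwise (g := fun r : Fin p =>
    Complex.exp (2 * Real.pi * Complex.I * (a * (r : ℕ) ^ 2 / p)) *
        HurwitzZeta.evenKernel (((r : ℕ) / p : ℝ) : UnitAddCircle) (2 * p ^ 2 * ε))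
      fun r => ?_).unique (hasSum_fintype _)
  have h3 := HurwitzZeta.hasSum_int_evenKernel ((r : ℕ) / p : ℝ)
    (t := 2 * p ^ 2 * ε) (by positivity)
  have h4 := (Complex.hasSum_ofReal.mpr h3).mul_left
    (Complex.exp (2 * Real.pi * Complex.I * (a * (r : ℕ) ^ 2 / p)))
  refine h4.congr_fun fun k => ?_
  simp only [Function.comp_apply, Equiv.prodComm_apply, Prod.swap_prod_mk,
    Int.divModEquiv_symm_apply, Complex.ofReal_exp]
  rw [← Complex.exp_add, Complex.exp_eq_exp_iff_exists_int]
  refine ⟨a * (k ^ 2 * p + 2 * k * (r : ℕ)), ?_⟩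
  push_cast
  field_simp
  linear_combination ((p : ℂ) * ε * (p * k + (r : ℕ)) ^ 2) * Complex.I_sq

lemma tendsto_sqrt_mul_ramanujanPhi_rational (a : ℤ) (p : ℕ) [NeZero p] :
    Tendsto (fun ε : ℝ => (√(2 * p ^ 2 * ε) : ℂ) * ramanujanPhi (a / p + Complex.I * ε)) (𝓝[>] 0)
      (𝓝 (∑ r : Fin p, Complex.exp (2 * Real.pi * Complex.I * (a * (r : ℕ) ^ 2 / p)))) := by
  have hp' : (0 : ℝ) < p := Nat.cast_pos.mpr (NeZero.pos p)
  have h0 : Tendsto (fun ε : ℝ => 2 * p ^ 2 * ε) (𝓝[>] 0) (𝓝[>] 0) := by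
    refine tendsto_nhdsWithin_iff.mpr ⟨?_, ?_⟩
    · have : Tendsto (fun ε : ℝ => 2 * p ^ 2 * ε) (𝓝 0) (𝓝 (2 * (p : ℝ) ^ 2 * 0)) :=
        (continuous_const_mul (2 * (p : ℝ) ^ 2)).tendsto 0
      rw [mul_zero] at this
      exact this.mono_left nhdsWithin_le_nhds
    · filter_upwards [self_mem_nhdsWithin] with x (hx : 0 < x)
      exact Set.mem_Ioi.mpr (by positivity)
  have h1 : ∀ r : Fin p, Tendsto (fun ε : ℝ =>
      Complex.exp (2 * Real.pi * Complex.I * (a * (r : ℕ) ^ 2 / p)) *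
      ((√(2 * p ^ 2 * ε) * HurwitzZeta.evenKernel (((r : ℕ) / p : ℝ) : UnitAddCircle)
        (2 * p ^ 2 * ε) : ℝ) : ℂ)) (𝓝[>] 0)
      (𝓝 (Complex.exp (2 * Real.pi * Complex.I * (a * (r : ℕ) ^ 2 / p)) * ((1 : ℝ) : ℂ))) :=
    fun r => ((Complex.continuous_ofReal.tendsto _).comp
      ((tendsto_sqrt_mul_evenKernel _).comp h0)).const_mul _
  have h2 := tendsto_finsetSum Finset.univ fun r _ => h1 r
  simp only [Complex.ofReal_one, mul_one] at h2
  refine h2.congr' ?_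
  filter_upwards [self_mem_nhdsWithin] with ε (hε : 0 < ε)
  rw [ramanujanPhi_rational_add_I_mul a p hε, Finset.mul_sum]
  refine Finset.sum_congr rfl fun r _ => ?_
  push_cast
  ring

end CuspAsymptotics

/-! ### Quadratic Gauss sums modulo an odd prime. -/

section QuadraticGaussSum

variable (p : ℕ) [Fact p.Prime]

/-- Each `y` has `1 + χ(y)` square roots, `χ` being the quadratic character. -/
lemma sum_comp_sq_zmod (hp : p ≠ 2) (f : ZMod p → ℂ) :
    ∑ x : ZMod p, f (x ^ 2) = ∑ y : ZMod p, ((quadraticChar (ZMod p) y : ℂ) + 1) * f y := by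
  classical
  rw [← Finset.sum_fiberwise_of_maps_to (s := Finset.univ) (t := Finset.univ)
    (g := fun x : ZMod p => x ^ 2) (fun _ _ => Finset.mem_univ _)]
  refine Finset.sum_congr rfl fun y _ => ?_
  rw [Finset.sum_congr rfl (g := fun _ => f y)
    (fun x hx => by rw [(Finset.mem_filter.mp hx).2]), Finset.sum_const, nsmul_eq_mul]
  congr 1
  have h := quadraticChar_card_sqrts (F := ZMod p) (by rwa [ZMod.ringChar_zmod_n]) y
  have h2 : (Finset.univ.filter fun x : ZMod p => x ^ 2 = y) =
      {x : ZMod p | x ^ 2 = y}.toFinset := by ext; simp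
  rw [h2]
  exact_mod_cast h

/-- A quadratic exponential sum in terms of the Gauss sum of the quadratic character. -/
lemma sum_exp_sq_eq (hp : p ≠ 2) {a : ℤ} (ha : (a : ZMod p) ≠ 0) :
    ∑ r : Fin p, Complex.exp (2 * Real.pi * Complex.I * (a * (r : ℕ) ^ 2 / p)) =
      quadraticChar (ZMod p) a * gaussSum ((quadraticChar (ZMod p)).ringHomComp (Int.castRingHom ℂ))
        (ZMod.stdAddChar (N := p)) := by
  have h1 : ∑ r : Fin p, Complex.exp (2 * Real.pi * Complex.I * (a * (r : ℕ) ^ 2 / p)) =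
      ∑ x : ZMod p, ZMod.stdAddChar (N := p) (a * x ^ 2) := by
    refine Fintype.sum_bijective (fun r : Fin p => ((r : ℕ) : ZMod p)) ?_ _ _ fun r => ?_
    · rw [Fintype.bijective_iff_injective_and_card]
      refine ⟨fun r s h => ?_, by simp⟩
      have := (ZMod.natCast_eq_natCast_iff' _ _ _).mp h
      rw [Nat.mod_eq_of_lt r.2, Nat.mod_eq_of_lt s.2] at this
      exact Fin.ext this
    · have h := ZMod.stdAddChar_coe (N := p) (a * (r : ℕ) ^ 2)
      push_cast at h
      rw [h]
      congr 1
      ring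
  rw [h1, sum_comp_sq_zmod p hp (fun y => ZMod.stdAddChar (N := p) (a * y))]
  simp_rw [add_mul, one_mul, Finset.sum_add_distrib]
  have h2 : ∑ y : ZMod p, ZMod.stdAddChar (N := p) (a * y) = (0 : ℂ) := by
    have := AddChar.sum_eq_zero_of_ne_one ((ZMod.isPrimitive_stdAddChar p) ha)
    simpa [AddChar.mulShift_apply] using this
  rw [h2, add_zero]
  have h3 := gaussSum_mulShift ((quadraticChar (ZMod p)).ringHomComp (Int.castRingHom ℂ))
    (ZMod.stdAddChar (N := p)) (Units.mk0 _ ha)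
  rw [← h3, ← mul_assoc]
  have h4 : (quadraticChar (ZMod p) (a : ZMod p) : ℂ) *
      ((quadraticChar (ZMod p)).ringHomComp (Int.castRingHom ℂ)) (Units.mk0 _ ha) = 1 := by
    rw [MulChar.ringHomComp_apply, Units.val_mk0, eq_intCast]
    exact_mod_cast (by rw [← sq]; exact quadraticChar_sq_one ha)
  rw [h4, one_mul]
  simp [gaussSum, AddChar.mulShift_apply]

/-- The square suffices, because Gauss sums will occur to an even total power; their sign is never
needed. -/
lemma gaussSum_quadraticChar_sq (hp : p ≠ 2) :
    gaussSum ((quadraticChar (ZMod p)).ringHomComp (Int.castRingHom ℂ))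
      (ZMod.stdAddChar (N := p)) ^ 2 = quadraticChar (ZMod p) (-1) * p := by
  rw [gaussSum_sq _ ((quadraticChar_isQuadratic (ZMod p)).comp _) (ZMod.isPrimitive_stdAddChar p)]
  · simp
  · rw [Ne, ← MulChar.ringHomComp_one (Int.castRingHom ℂ)]
    intro h
    exact quadraticChar_ne_one (by rwa [ZMod.ringChar_zmod_n])
      (MulChar.injective_ringHomComp (RingHom.injective_int _) h)

end QuadraticGaussSum

/-! ### Generators of `Γ₀(4)`. -/

section GammaZeroFour

open Matrix Matrix.SpecialLinearGroup CongruenceSubgroup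

/-- The lower unipotent matrix `(1, 0; n, 1)`. -/
def lowerUnipotent (n : ℤ) : SL(2, ℤ) := ⟨!![1, 0; n, 1], by simp [Matrix.det_fin_two]⟩

lemma Int.exists_two_mul_abs_add_mul_le (x : ℤ) {m : ℤ} (hm : m ≠ 0) :
    ∃ k : ℤ, 2 * |x + m * k| ≤ |m| := by
  have h0 := Int.emod_nonneg x hm
  have h1 := Int.emod_lt_abs x hm
  have h2 := Int.emod_add_mul_ediv x m
  rcases le_or_gt (2 * (x % m)) |m| with h | h
  · refine ⟨-(x / m), ?_⟩
    rw [show x + m * -(x / m) = x % m by linarith, abs_of_nonneg h0]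
    exact h
  · refine ⟨-(x / m) - m.sign, ?_⟩
    have h3 : m * m.sign = |m| := Int.mul_sign_self m ▸ (Int.abs_eq_natAbs m).symm
    rw [show x + m * (-(x / m) - m.sign) = x % m - |m| by rw [mul_sub, h3]; linarith, abs_of_neg
      (by linarith)]
    linarith

/-- `Γ₀(4)` is generated by `-1`, the translations and the matrices `(1, 0; 4 n, 1)`. -/
lemma Gamma0_four_le {H : Subgroup SL(2, ℤ)} (hneg : -1 ∈ H) (hT : ∀ n : ℤ, ModularGroup.T ^ n ∈ H)
    (hV : ∀ n : ℤ, lowerUnipotent (4 * n) ∈ H) : Gamma0 4 ≤ H := by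
  suffices h : ∀ (n : ℕ) (γ : SL(2, ℤ)), γ ∈ Gamma0 4 → (γ 1 0).natAbs = n → γ ∈ H from
    fun γ hγ => h _ γ hγ rfl
  intro n
  induction n using Nat.strong_induction_on with
  | _ n ih =>
  intro γ hγ hn
  have hc4 : (4 : ℤ) ∣ γ 1 0 := (ZMod.intCast_zmod_eq_zero_iff_dvd _ 4).mp (Gamma0_mem.mp hγ)
  have hdet : γ 0 0 * γ 1 1 - γ 0 1 * γ 1 0 = 1 := by
    rw [← Matrix.det_fin_two]; exact γ.det_coe
  rcases eq_or_ne (γ 1 0) 0 with hc | hc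
  · rw [hc, mul_zero, sub_zero] at hdet
    rcases Int.mul_eq_one_iff_eq_one_or_neg_one.mp hdet with ⟨h0, h1⟩ | ⟨h0, h1⟩
    · have : γ = ModularGroup.T ^ (γ 0 1) := by
        ext i j
        rw [ModularGroup.coe_T_zpow]
        fin_cases i <;> fin_cases j <;> simp [h0, h1, hc]
      rw [this]
      exact hT _
    · have : γ = -1 * ModularGroup.T ^ (-γ 0 1) := by
        ext i j
        rw [neg_one_mul, coe_neg, ModularGroup.coe_T_zpow]
        fin_cases i <;> fin_cases j <;> simp [h0, h1, hc]
      rw [this]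
      exact H.mul_mem hneg (hT _)
  -- Euclidean descent on the bottom row `(c, d)`: a translation reduces `d` modulo `c`, then a
  -- lower unipotent matrix reduces `c` modulo `4 d`.
  obtain ⟨k, hk⟩ := Int.exists_two_mul_abs_add_mul_le (γ 1 1) hc
  set d := γ 1 1 + γ 1 0 * k with hd
  obtain ⟨e, he⟩ := hc4
  have hodd : d % 2 = 1 := by
    have h1 : (γ 0 0 * γ 1 1) % 2 = 1 := by
      rw [he] at hdet
      have : γ 0 0 * γ 1 1 = 1 + 2 * (2 * (γ 0 1 * e)) := by linarith
      omega
    have h2 : γ 1 1 % 2 = 1 := by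
      rcases Int.emod_two_eq_zero_or_one (γ 1 1) with h | h
      · rw [Int.mul_emod, h] at h1
        simp at h1
      · exact h
    have h3 : d = γ 1 1 + 2 * (2 * (e * k)) := by rw [hd, he]; ring
    omega
  have hd0 : d ≠ 0 := by rintro h; rw [h] at hodd; simp at hodd
  obtain ⟨j, hj⟩ := Int.exists_two_mul_abs_add_mul_le (γ 1 0) (m := 4 * d) (by omega)
  set δ := γ * ModularGroup.T ^ k * lowerUnipotent (4 * j) with hδ
  have hδ10 : δ 1 0 = γ 1 0 + 4 * d * j := by
    rw [hδ, coe_mul, coe_mul, ModularGroup.coe_T_zpow, lowerUnipotent]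
    simp [Matrix.mul_apply, Fin.sum_univ_two]
    rw [hd]
    ring
  have hδmem : δ ∈ H := by
    refine ih _ ?_ δ ?_ rfl
    -- The new entry is at most `2 |d| ≤ |c|` in absolute value. The second inequality is strict
    -- because `d` is odd while `|c| = 4 |e|`.
    · rw [← hn, hδ10]
      have h1 : |4 * d| = 4 * |d| := abs_mul 4 d
      have h2 : |γ 1 0| = 4 * |e| := by rw [he, abs_mul]; rfl
      rw [← Int.ofNat_lt, Int.natCast_natAbs, Int.natCast_natAbs]
      rcases abs_choice d with h | h <;> omega
    · rw [Gamma0_mem, hδ10, he]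
      have : (4 : ZMod 4) = 0 := rfl
      push_cast
      rw [this]
      ring
  have hγ' : γ = δ * (lowerUnipotent (4 * j))⁻¹ * (ModularGroup.T ^ k)⁻¹ := by
    rw [hδ]; group
  rw [hγ']
  exact H.mul_mem (H.mul_mem hδmem (H.inv_mem (hV j))) (H.inv_mem (hT k))

end GammaZeroFour

/-! ### The square of theta as an eigenfunction of `Γ₀(4)`. -/

section SlashEigen

open CongruenceSubgroup

/-- The subgroup of the matrices which act on `f` by a nonzero scalar in weight `k`. -/
def slashEigenSubgroup (k : ℤ) (f : ℍ → ℂ) : Subgroup SL(2, ℤ) where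
  carrier := {γ | ∃ s : ℂ, s ≠ 0 ∧ f ∣[k] γ = s • f}
  one_mem' := ⟨1, one_ne_zero, by rw [SlashAction.slash_one, one_smul]⟩
  mul_mem' := by
    rintro γ δ ⟨s, hs, h⟩ ⟨t, ht, h'⟩
    refine ⟨s * t, mul_ne_zero hs ht, ?_⟩
    rw [SlashAction.slash_mul, h, ModularForm.SL_smul_slash, h', smul_smul]
  inv_mem' := by
    rintro γ ⟨s, hs, h⟩
    refine ⟨s⁻¹, inv_ne_zero hs, ?_⟩
    have h1 : (f ∣[k] γ) ∣[k] γ⁻¹ = f := by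
      rw [← SlashAction.slash_mul, mul_inv_cancel, SlashAction.slash_one]
    rw [h, ModularForm.SL_smul_slash] at h1
    rw [← h1, ModularForm.SL_smul_slash, smul_smul, inv_mul_cancel₀ hs, one_smul]
    rw [← ModularForm.SL_smul_slash, h1]

lemma coe_SL_smul (γ : SL(2, ℤ)) (z : ℍ) :
    ((γ • z : ℍ) : ℂ) = (γ 0 0 * z + γ 0 1) / (γ 1 0 * z + γ 1 1) := by
  simpa using UpperHalfPlane.coe_specialLinearGroup_apply γ z

lemma SL_denom_ne_zero (γ : SL(2, ℤ)) (z : ℍ) : (γ 1 0 * z + γ 1 1 : ℂ) ≠ 0 :=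
  UpperHalfPlane.denom_ne_zero γ z

lemma SL_slash_apply' (f : ℍ → ℂ) (k : ℤ) (γ : SL(2, ℤ)) (z : ℍ) :
    (f ∣[k] γ) z = f (γ • z) * (γ 1 0 * z + γ 1 1 : ℂ) ^ (-k) :=
  ModularForm.SL_slash_apply f γ z

/-- The square of Ramanujan's theta function is an eigenfunction of `Γ₀(4)` in weight one. -/
lemma Gamma0_four_le_slashEigenSubgroup :
    Gamma0 4 ≤ slashEigenSubgroup 1 fun z : ℍ => ramanujanPhi z ^ 2 := by
  refine Gamma0_four_le ⟨-1, by simp, ?_⟩ (fun n => ⟨1, one_ne_zero, ?_⟩)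
    (fun n => ⟨1, one_ne_zero, ?_⟩)
  · ext z
    rw [SL_slash_apply']
    simp
  · ext z
    rw [SL_slash_apply', UpperHalfPlane.modular_T_zpow_smul, UpperHalfPlane.coe_vadd,
      ModularGroup.coe_T_zpow, add_comm]
    have := ramanujanPhi_add_int z n
    simp [this]
  · ext z
    have h0 := SL_denom_ne_zero (lowerUnipotent (4 * n)) z
    have hz := z.ne_zero
    rw [SL_slash_apply', coe_SL_smul]
    simp only [lowerUnipotent] at h0 ⊢
    simp only [Matrix.of_apply, Matrix.cons_val', Matrix.cons_val_zero, Matrix.cons_val_one,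
      Int.cast_mul, Int.cast_one, Int.cast_zero, Int.cast_ofNat, one_mul, add_zero, one_smul,
      zpow_neg_one, Matrix.cons_val_fin_one] at h0 ⊢
    -- The Fricke involution conjugates `(1, 0; 4 n, 1)` to translation by `-n`: take the Fricke
    -- image of `z`, translate, and return. Squaring removes the branches of the square root.
    set w : ℂ := -1 / (4 * z) + (-n : ℤ) with hw
    have hw0 : w = -(4 * n * z + 1) / (4 * z) := by rw [hw]; push_cast; field_simp; ring
    have hwne : w ≠ 0 := by
      rw [hw0]
      exact div_ne_zero (neg_ne_zero.mpr h0) (by simp [hz])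
    have hwim : 0 < w.im := by
      have h1 : -1 / (4 * (z : ℂ)) = ((1 / 4 : ℝ) : ℂ) * (-(z : ℂ))⁻¹ := by
        push_cast; field_simp
      rw [hw, Complex.add_im, Complex.intCast_im, add_zero, h1, Complex.im_ofReal_mul]
      have := UpperHalfPlane.im_inv_neg_coe_pos z
      positivity
    have h1 : (z : ℂ) / (4 * n * z + 1) = -1 / (4 * w) := by
      rw [hw0]
      field_simp
    have h2 := ramanujanPhi_fricke hwim
    have h3 := ramanujanPhi_fricke z.im_pos
    rw [hw, ramanujanPhi_add_int, h3, ← hw] at h2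
    have hsq : ∀ x : ℂ, (x ^ (1 / 2 : ℂ)) ^ 2 = x := fun x => by
      rw [one_div]; exact_mod_cast Complex.cpow_nat_inv_pow x two_ne_zero
    rw [h1, h2, mul_pow, mul_pow, hsq, hsq, hw0]
    field_simp
    linear_combination (ramanujanPhi z ^ 2) * (-4 : ℂ) * Complex.I_sq

end SlashEigen

/-! ### Products of theta functions as eigenfunctions. -/

section ThetaProduct

open CongruenceSubgroup

/-- The product of the functions `φ(m z) ^ l m` over `m ∈ S`. -/
noncomputable def thetaProduct (S : Finset ℕ) (l : ℕ → ℕ) (z : ℍ) : ℂ :=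
  ∏ m ∈ S, ramanujanPhi (m * z) ^ l m

lemma mdifferentiable_thetaProduct {S : Finset ℕ} (hS : ∀ m ∈ S, 0 < m) (l : ℕ → ℕ) :
    MDiff (thetaProduct S l) := by
  have h : thetaProduct S l = ∏ m ∈ S, (fun z : ℍ => ramanujanPhi (m * z)) ^ l m := by
    ext z; simp [thetaProduct]
  rw [h]
  exact MDifferentiable.prod fun m hm => (mdifferentiable_ramanujanPhi_mul (hS m hm)).pow (l m)

/-- Conjugation by `z ↦ m z` turns `(a, b; c, d)` into `(a, m b; c / m, d)`, which lies in `Γ₀(4)`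
because `4 m ∣ c`. -/
lemma exists_ramanujanPhi_mul_smul_sq {N m : ℕ} (hm : 0 < m) (hmN : 4 * m ∣ N) {γ : SL(2, ℤ)}
    (hγ : γ ∈ Gamma0 N) : ∃ s : ℂ, s ≠ 0 ∧ ∀ z : ℍ, ramanujanPhi (m * (γ • z : ℍ)) ^ 2 =
      s * (γ 1 0 * z + γ 1 1) * ramanujanPhi (m * z) ^ 2 := by
  have hc : ((4 * m : ℕ) : ℤ) ∣ γ 1 0 :=
    (Int.natCast_dvd_natCast.mpr hmN).trans ((ZMod.intCast_zmod_eq_zero_iff_dvd _ N).mp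
      (Gamma0_mem.mp hγ))
  obtain ⟨c, hc⟩ := hc
  have hdet : γ 0 0 * γ 1 1 - γ 0 1 * γ 1 0 = 1 := by
    rw [← Matrix.det_fin_two]; exact γ.det_coe
  let δ : SL(2, ℤ) := ⟨!![γ 0 0, m * γ 0 1; 4 * c, γ 1 1], by
    rw [Matrix.det_fin_two_of]; rw [hc] at hdet; push_cast at hdet; linarith⟩
  have hδ : δ ∈ Gamma0 4 := by
    rw [Gamma0_mem]
    have : (4 : ZMod 4) = 0 := rfl
    simp [δ, this]
  obtain ⟨s, hs, h⟩ := Gamma0_four_le_slashEigenSubgroup hδ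
  refine ⟨s, hs, fun z => ?_⟩
  have hmz : 0 < ((m : ℂ) * z).im := by
    simpa using mul_pos (Nat.cast_pos.mpr hm) z.im_pos
  have h1 := congrFun h ⟨m * z, hmz⟩
  have hd := SL_denom_ne_zero δ ⟨m * z, hmz⟩
  have h3 := SL_denom_ne_zero γ z
  rw [SL_slash_apply', coe_SL_smul, zpow_neg_one, Pi.smul_apply, smul_eq_mul] at h1
  have h2 : (δ 1 0 * (m * z) + δ 1 1 : ℂ) = γ 1 0 * z + γ 1 1 := by
    simp [δ, hc]; ring
  have h4 : (δ 0 0 * (m * z) + δ 0 1 : ℂ) = m * (γ 0 0 * z + γ 0 1) := by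
    simp [δ]; ring
  simp only [h2, h4] at h1
  rw [coe_SL_smul, ← mul_div_assoc]
  rw [mul_inv_eq_iff_eq_mul₀ h3] at h1
  rw [h1]
  ring

/-- A product of `2 k` theta functions is an eigenfunction in weight `k`. -/
lemma exists_thetaProduct_slash {N k : ℕ} {S : Finset ℕ} (hS : ∀ m ∈ S, 0 < m)
    (hN : ∀ m ∈ S, 4 * m ∣ N) {l : ℕ → ℕ} (hl : ∑ m ∈ S, l m = 2 * k) {γ : SL(2, ℤ)}
    (hγ : γ ∈ Gamma0 N) : ∃ s : ℂ, thetaProduct S l ∣[(k : ℤ)] γ = s • thetaProduct S l := by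
  have h : ∀ m, ∃ s : ℂ, m ∈ S → ∀ z : ℍ, ramanujanPhi (m * (γ • z : ℍ)) ^ 2 =
      s * (γ 1 0 * z + γ 1 1) * ramanujanPhi (m * z) ^ 2 := by
    intro m
    by_cases hm : m ∈ S
    · obtain ⟨s, -, h⟩ := exists_ramanujanPhi_mul_smul_sq (hS m hm) (hN m hm) hγ
      exact ⟨s, fun _ => h⟩
    · exact ⟨0, fun h => absurd h hm⟩
  choose s hs using h
  obtain ⟨t, ht⟩ := IsAlgClosed.exists_pow_nat_eq (∏ m ∈ S, s m ^ l m) two_pos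
  set F := thetaProduct S l with hF
  have hFd : MDiff F := mdifferentiable_thetaProduct hS l
  have hGd : MDiff (F ∣[(k : ℤ)] γ) := hFd.slash k γ
  -- Squares of eigenfunctions give `(F ∣ γ) ^ 2 = t ^ 2 F ^ 2`. One of the two holomorphic factors
  -- must then vanish identically, which fixes a single sign on all of `ℍ`.
  have hsq : (F ∣[(k : ℤ)] γ - t • F) * (F ∣[(k : ℤ)] γ + t • F) = 0 := by
    ext z
    have hd := SL_denom_ne_zero γ z
    have h1 : F (γ • z) ^ 2 = t ^ 2 * (γ 1 0 * z + γ 1 1) ^ (2 * k) * F z ^ 2 := by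
      simp only [hF, thetaProduct]
      rw [← Finset.prod_pow, ← Finset.prod_pow, ht, ← hl, ← Finset.prod_pow_eq_pow_sum,
        ← Finset.prod_mul_distrib, ← Finset.prod_mul_distrib]
      refine Finset.prod_congr rfl fun m hm => ?_
      rw [pow_right_comm, hs m hm z, mul_pow, mul_pow, pow_right_comm]
    have h2 : (F ∣[(k : ℤ)] γ) z ^ 2 = t ^ 2 * F z ^ 2 := by
      rw [SL_slash_apply', mul_pow, h1, zpow_neg, zpow_natCast, pow_mul']
      field_simp
    simp only [Pi.mul_apply, Pi.sub_apply, Pi.add_apply, Pi.smul_apply, smul_eq_mul,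
      Pi.zero_apply]
    linear_combination h2
  rcases (UpperHalfPlane.mul_eq_zero_iff (hGd.sub (hFd.const_smul t))
    (hGd.add (hFd.const_smul t))).mp hsq with h | h
  · exact ⟨t, sub_eq_zero.mp h⟩
  · exact ⟨-t, by rw [_root_.neg_smul]; exact eq_neg_of_add_eq_zero_left h⟩

end ThetaProduct

/-! ### The eigenvalue when the lower right entry is an odd prime. -/

section PrimeDenominator

open Filter Topology

/-- Extracting the positive `√m` leaves a square root independent of `m`, so that in a product of `2
k` factors it occurs to an even power. -/
lemma ramanujanPhi_mul_fricke {m : ℕ} (hm : 0 < m) (z : ℍ) :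
    ramanujanPhi (-1 / (4 * z) / m) =
      √m * (-2 * Complex.I * z) ^ (1 / 2 : ℂ) * ramanujanPhi (m * z) := by
  have hmz : 0 < ((m : ℂ) * z).im := by
    simpa using mul_pos (Nat.cast_pos.mpr hm) z.im_pos
  have h := ramanujanPhi_fricke hmz
  rw [div_div, mul_assoc, mul_comm (z : ℂ) m, h]
  congr 1
  rw [show -2 * Complex.I * ((m : ℂ) * z) = ((m : ℝ) : ℂ) * (-2 * Complex.I * z) by
    push_cast; ring]
  have hm' : (0 : ℝ) < m := Nat.cast_pos.mpr hm
  have hz : -2 * Complex.I * (z : ℂ) ≠ 0 := by simp [z.ne_zero]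
  rw [Complex.cpow_def_of_ne_zero (mul_ne_zero (Complex.ofReal_ne_zero.mpr hm'.ne') hz),
    Complex.log_ofReal_mul hm' hz, add_mul, Complex.exp_add, ← Complex.cpow_def_of_ne_zero hz,
    Complex.ofReal_log hm'.le,
    ← Complex.cpow_def_of_ne_zero (Complex.ofReal_ne_zero.mpr hm'.ne'), Real.sqrt_eq_rpow,
    Complex.ofReal_cpow hm'.le]
  norm_num

lemma prod_pow_mul_const {S : Finset ℕ} {l : ℕ → ℕ} {n : ℕ} (hl : ∑ m ∈ S, l m = n)
    (f : ℕ → ℂ) (c : ℂ) : ∏ m ∈ S, (f m * c) ^ l m = (∏ m ∈ S, f m ^ l m) * c ^ n := by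
  rw [← hl, ← Finset.prod_pow_eq_pow_sum, ← Finset.prod_mul_distrib]
  exact Finset.prod_congr rfl fun m _ => mul_pow _ _ _

/-- Comparison of a product of theta functions close to the cusp `b / p` with its expansion at the
cusp `0`, for a matrix `γ` with lower right entry `p`. -/
lemma prod_ramanujanPhi_rational {k p : ℕ} (hp : 0 < p) {S : Finset ℕ} (hS : ∀ m ∈ S, 0 < m)
    {l : ℕ → ℕ} (hl : ∑ m ∈ S, l m = 2 * k) {γ : SL(2, ℤ)} (hγ : γ 1 1 = p) {s : ℂ}
    (hs : thetaProduct S l ∣[(k : ℤ)] γ = s • thetaProduct S l) {ε : ℝ} (hε : 0 < ε) :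
    ∏ m ∈ S, ((√(2 * p ^ 2 * (m * ε)) : ℂ) *
      ramanujanPhi ((m * γ 0 1 : ℤ) / p + Complex.I * (m * ε : ℝ))) ^ l m =
    s * p ^ k * ∏ m ∈ S, ramanujanPhi
      ((Complex.I / (4 * p ^ 2 * ε) + γ 1 0 / (4 * p)) / m) ^ l m := by
  have hdet : (γ 0 0 * p - γ 0 1 * γ 1 0 : ℂ) = 1 := by
    have : γ 0 0 * γ 1 1 - γ 0 1 * γ 1 0 = 1 := by
      rw [← Matrix.det_fin_two]; exact γ.det_coe
    rw [hγ] at this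
    exact_mod_cast this
  have hpC : (p : ℂ) ≠ 0 := Nat.cast_ne_zero.mpr hp.ne'
  have hεC : (ε : ℂ) ≠ 0 := Complex.ofReal_ne_zero.mpr hε.ne'
  have him : 0 < ((γ 0 1 : ℂ) / p + Complex.I * ε).im := by
    have : ((γ 0 1 : ℂ) / p) = (((γ 0 1 : ℝ) / p : ℝ) : ℂ) := by push_cast; rfl
    rw [this]
    simpa using hε
  -- As `ε → 0`, `τ` descends to the cusp `b / p = γ 0`, so `z` tends to `0` and its Fricke image
  -- rises to `i∞` along a vertical line.
  set τ : ℍ := ⟨(γ 0 1 : ℂ) / p + Complex.I * ε, him⟩ with hτ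
  set z : ℍ := γ⁻¹ • τ with hz
  have hγz : γ • z = τ := smul_inv_smul γ τ
  have hD := SL_denom_ne_zero γ z
  have hz0 : (z : ℂ) ≠ 0 := z.ne_zero
  have h1 := coe_SL_smul γ z
  rw [hγz, eq_div_iff hD, hτ, hγ] at h1
  rw [hγ] at hD
  simp only [Int.cast_natCast] at h1 hD
  set D : ℂ := γ 1 0 * z + p with hDdef
  have h2 : (z : ℂ) = Complex.I * p * ε * D := by
    rw [hDdef] at h1 ⊢
    field_simp at h1
    linear_combination (-(z : ℂ)) * hdet - h1
  have h3 : Complex.I / (4 * p ^ 2 * ε) + γ 1 0 / (4 * p) = -1 / (4 * (z : ℂ)) := by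
    rw [hDdef] at h2
    field_simp
    linear_combination Complex.I * h2 + (p * ε * (γ 1 0 * z + p) : ℂ) * Complex.I_sq
  have h4 : (-2 * Complex.I * z : ℂ) = 2 * p * ε * D := by
    linear_combination (-2 * Complex.I) * h2 - (2 * p * ε * D) * Complex.I_sq
  have hq : ((-2 * Complex.I * z : ℂ) ^ (1 / 2 : ℂ)) ^ 2 = 2 * p * ε * D := by
    rw [one_div, ← h4]; exact_mod_cast Complex.cpow_nat_inv_pow _ two_ne_zero
  have h5 : ∏ m ∈ S, ramanujanPhi
      ((Complex.I / (4 * p ^ 2 * ε) + γ 1 0 / (4 * p)) / m) ^ l m =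
      (∏ m ∈ S, (√m : ℂ) ^ l m) * (2 * p * ε * D) ^ k * thetaProduct S l z := by
    rw [h3, ← hq, ← pow_mul, ← prod_pow_mul_const hl, thetaProduct, ← Finset.prod_mul_distrib]
    refine Finset.prod_congr rfl fun m hm => ?_
    rw [ramanujanPhi_mul_fricke (hS m hm), mul_pow]
  have h6 : ∏ m ∈ S, ((√(2 * p ^ 2 * (m * ε)) : ℂ) *
      ramanujanPhi ((m * γ 0 1 : ℤ) / p + Complex.I * (m * ε : ℝ))) ^ l m =
      (∏ m ∈ S, (√m : ℂ) ^ l m) * (2 * p ^ 2 * ε) ^ k * thetaProduct S l τ := by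
    have hr : ((√(2 * p ^ 2 * ε) : ℝ) : ℂ) ^ 2 = 2 * p ^ 2 * ε := by
      rw [← Complex.ofReal_pow, Real.sq_sqrt (by positivity)]
      push_cast; rfl
    rw [← hr, ← pow_mul, ← prod_pow_mul_const hl, thetaProduct, ← Finset.prod_mul_distrib]
    refine Finset.prod_congr rfl fun m hm => ?_
    rw [mul_pow, ← Complex.ofReal_mul, ← Real.sqrt_mul (Nat.cast_nonneg m)]
    congr 2
    · congr 2
      ring
    · congr 1
      simp only [hτ]
      push_cast
      ring
  have h7 := congrFun hs z
  rw [SL_slash_apply', hγz, hγ, zpow_neg, zpow_natCast, Pi.smul_apply, smul_eq_mul,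
    Int.cast_natCast, ← hDdef, mul_inv_eq_iff_eq_mul₀ (pow_ne_zero k hD)] at h7
  rw [h6, h5, h7]
  simp only [mul_pow]
  ring

/-- The eigenvalue of a product of theta functions under a matrix whose lower right entry is an odd
prime. -/
lemma thetaProduct_slash_eigenvalue_of_prime {k p : ℕ} [Fact p.Prime] (hp : p ≠ 2) {S : Finset ℕ}
    (hS : ∀ m ∈ S, 0 < m) (hpS : ∀ m ∈ S, ¬ p ∣ m) {l : ℕ → ℕ} (hl : ∑ m ∈ S, l m = 2 * k)
    {γ : SL(2, ℤ)} (hγ : γ 1 1 = p) {s : ℂ}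
    (hs : thetaProduct S l ∣[(k : ℤ)] γ = s • thetaProduct S l) :
    s = jacobiSym ((-1) ^ k * ∏ m ∈ S, (m : ℤ) ^ l m) p := by
  have hp0 : 0 < p := (Fact.out : p.Prime).pos
  have hpC : (p : ℂ) ≠ 0 := Nat.cast_ne_zero.mpr hp0.ne'
  have hpR : (0 : ℝ) < p := Nat.cast_pos.mpr hp0
  have hb : ((γ 0 1 : ℤ) : ZMod p) ≠ 0 := by
    have : γ 0 0 * γ 1 1 - γ 0 1 * γ 1 0 = 1 := by
      rw [← Matrix.det_fin_two]; exact γ.det_coe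
    have h := congrArg (Int.cast : ℤ → ZMod p) this
    rw [hγ] at h
    push_cast at h
    intro h0
    simp [h0] at h
  have hlim1 : Tendsto (fun ε : ℝ => ∏ m ∈ S, ((√(2 * p ^ 2 * (m * ε)) : ℂ) *
      ramanujanPhi ((m * γ 0 1 : ℤ) / p + Complex.I * (m * ε : ℝ))) ^ l m) (𝓝[>] 0)
      (𝓝 (∏ m ∈ S, (∑ r : Fin p, Complex.exp (2 * Real.pi * Complex.I *
        ((m * γ 0 1 : ℤ) * (r : ℕ) ^ 2 / p))) ^ l m)) := by
    refine tendsto_finsetProd S fun m hm => Tendsto.pow ?_ _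
    have h0 : Tendsto (fun ε : ℝ => (m : ℝ) * ε) (𝓝[>] 0) (𝓝[>] 0) := by
      refine tendsto_nhdsWithin_iff.mpr ⟨?_, ?_⟩
      · have : Tendsto (fun ε : ℝ => (m : ℝ) * ε) (𝓝 0) (𝓝 ((m : ℝ) * 0)) :=
          (continuous_const_mul (m : ℝ)).tendsto 0
        rw [mul_zero] at this
        exact this.mono_left nhdsWithin_le_nhds
      · filter_upwards [self_mem_nhdsWithin] with x (hx : 0 < x)
        exact Set.mem_Ioi.mpr (mul_pos (Nat.cast_pos.mpr (hS m hm)) hx)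
    exact (tendsto_sqrt_mul_ramanujanPhi_rational (m * γ 0 1) p).comp h0
  have hlim2 : Tendsto (fun ε : ℝ => s * p ^ k * ∏ m ∈ S, ramanujanPhi
      ((Complex.I / (4 * p ^ 2 * ε) + γ 1 0 / (4 * p)) / m) ^ l m) (𝓝[>] 0)
      (𝓝 (s * p ^ k * ∏ m ∈ S, 1 ^ l m)) := by
    refine (tendsto_finsetProd S fun m hm => Tendsto.pow ?_ _).const_mul _
    refine tendsto_ramanujanPhi_im_atTop.comp (tendsto_comap_iff.mpr ?_)
    have hm0 : (0 : ℝ) < m := Nat.cast_pos.mpr (hS m hm)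
    have h : (Complex.im ∘ fun ε : ℝ => (Complex.I / (4 * p ^ 2 * ε) + γ 1 0 / (4 * p)) / m) =
        fun ε : ℝ => (4 * p ^ 2 * m : ℝ)⁻¹ * ε⁻¹ := by
      ext ε
      have : (Complex.I / (4 * p ^ 2 * ε) + γ 1 0 / (4 * p)) / m =
          ((γ 1 0 / (4 * p) / m : ℝ) : ℂ) +
            (((4 * p ^ 2 * m : ℝ)⁻¹ * ε⁻¹ : ℝ) : ℂ) * Complex.I := by
        push_cast
        rw [mul_inv]
        ring
      rw [Function.comp_apply, this, Complex.add_im, Complex.ofReal_im, Complex.im_ofReal_mul,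
        Complex.I_im, zero_add, mul_one]
    rw [h]
    exact tendsto_inv_nhdsGT_zero.const_mul_atTop (by positivity)
  -- The two limits of the same function give `∏ (Gauss sums) = s p ^ k`.
  have hlim := tendsto_nhds_unique (hlim1.congr' (by
    filter_upwards [self_mem_nhdsWithin] with ε (hε : 0 < ε)
    exact prod_ramanujanPhi_rational hp0 hS hl hγ hs hε)) hlim2
  simp only [one_pow, Finset.prod_const_one, mul_one] at hlim
  -- The character value at `b = γ 0 1` has total exponent `2 k` and disappears. The Gauss sum to
  -- the power `2 k` becomes `(χ(-1) p) ^ k`.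
  have hG : ∏ m ∈ S, (∑ r : Fin p, Complex.exp (2 * Real.pi * Complex.I *
        ((m * γ 0 1 : ℤ) * (r : ℕ) ^ 2 / p))) ^ l m =
      (∏ m ∈ S, (quadraticChar (ZMod p) m : ℂ) ^ l m) *
        ((quadraticChar (ZMod p) (-1) : ℂ) * p) ^ k := by
    have hb2 : (quadraticChar (ZMod p) (γ 0 1 : ℤ) : ℂ) ^ 2 = 1 := by
      exact_mod_cast quadraticChar_sq_one hb
    have h1 : ((quadraticChar (ZMod p) (γ 0 1 : ℤ) : ℂ) *
        gaussSum ((quadraticChar (ZMod p)).ringHomComp (Int.castRingHom ℂ))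
          (ZMod.stdAddChar (N := p))) ^ 2 = (quadraticChar (ZMod p) (-1) : ℂ) * p := by
      rw [mul_pow, hb2, one_mul, gaussSum_quadraticChar_sq p hp]
    rw [← h1, ← pow_mul, ← prod_pow_mul_const hl]
    refine Finset.prod_congr rfl fun m hm => ?_
    have hm0 : (m : ZMod p) ≠ 0 := fun h => hpS m hm ((ZMod.natCast_eq_zero_iff _ _).mp h)
    rw [sum_exp_sq_eq p hp (a := m * γ 0 1) (by push_cast; exact mul_ne_zero hm0 hb)]
    push_cast
    rw [map_mul]
    push_cast
    ring
  rw [hG, mul_pow, ← mul_assoc] at hlim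
  have hfin := mul_right_cancel₀ (pow_ne_zero k hpC) hlim
  rw [← hfin, ← jacobiSym.legendreSym.to_jacobiSym, legendreSym]
  push_cast
  rw [map_mul, map_pow, map_prod]
  simp_rw [map_pow]
  push_cast
  ring

end PrimeDenominator

/-! ### Reduction to prime lower right entry. -/

section Eigenvalue

open CongruenceSubgroup

lemma thetaProduct_slash_T_zpow (S : Finset ℕ) (l : ℕ → ℕ) (k n : ℤ) :
    thetaProduct S l ∣[k] (ModularGroup.T ^ n) = thetaProduct S l := by
  ext z
  rw [SL_slash_apply', UpperHalfPlane.modular_T_zpow_smul, ModularGroup.coe_T_zpow]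
  have h : ∀ m : ℕ, ramanujanPhi (m * (n + z)) = ramanujanPhi (m * z) := fun m => by
    have := ramanujanPhi_add_int (m * z) (m * n)
    rw [← this]
    congr 1
    push_cast
    ring
  simp [thetaProduct, UpperHalfPlane.coe_vadd, h]

/-- Right multiplication by `T ^ n` replaces `d` by `d + n c` and preserves the eigenvalue.
Dirichlet's theorem supplies a prime there, chosen above `max 2 N` so that it is odd and divides no
`m`. -/
lemma exists_prime_thetaProduct_slash {N k : ℕ} (hN0 : N ≠ 0) {S : Finset ℕ}
    (hS : ∀ m ∈ S, 0 < m) (hN : ∀ m ∈ S, 4 * m ∣ N) {l : ℕ → ℕ} (hl : ∑ m ∈ S, l m = 2 * k)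
    {γ : SL(2, ℤ)} (hγ : γ ∈ Gamma0 N) (hc : γ 1 0 ≠ 0) :
    ∃ p : ℕ, p.Prime ∧ (p : ℤ) ≡ γ 1 1 [ZMOD N] ∧ thetaProduct S l ∣[(k : ℤ)] γ =
      (jacobiSym ((-1) ^ k * ∏ m ∈ S, (m : ℤ) ^ l m) p : ℂ) • thetaProduct S l := by
  have hdet : γ 0 0 * γ 1 1 - γ 0 1 * γ 1 0 = 1 := by
    rw [← Matrix.det_fin_two]; exact γ.det_coe
  have hcop : IsCoprime (γ 1 1) ((γ 1 0).natAbs : ℤ) := by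
    rw [Int.natCast_natAbs, IsCoprime.abs_right_iff]
    exact ⟨γ 0 0, -γ 0 1, by linarith⟩
  obtain ⟨p, hpgt, hp, hpmod⟩ := Nat.forall_exists_prime_gt_and_zmodEq (max 2 N)
    (Int.natAbs_ne_zero.mpr hc) hcop
  have hp2 : p ≠ 2 := by have := le_max_left 2 N; omega
  have hpS : ∀ m ∈ S, ¬ p ∣ m := fun m hm hpm => by
    have h1 := Nat.le_of_dvd (hS m hm) hpm
    have h2 := Nat.le_of_dvd (Nat.pos_of_ne_zero hN0) (hN m hm)
    have := le_max_right 2 N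
    omega
  rw [Int.natCast_natAbs] at hpmod
  have hNc : (N : ℤ) ∣ γ 1 0 := (ZMod.intCast_zmod_eq_zero_iff_dvd _ N).mp (Gamma0_mem.mp hγ)
  refine ⟨p, hp, hpmod.of_dvd ((dvd_abs _ _).mpr hNc), ?_⟩
  obtain ⟨s, hs⟩ := exists_thetaProduct_slash hS hN hl hγ
  obtain ⟨n, hn⟩ : γ 1 0 ∣ p - γ 1 1 := (abs_dvd _ _).mp hpmod.symm.dvd
  have : Fact p.Prime := ⟨hp⟩
  have h1 : thetaProduct S l ∣[(k : ℤ)] (γ * ModularGroup.T ^ n) = s • thetaProduct S l := by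
    rw [SlashAction.slash_mul, hs, ModularForm.SL_smul_slash, thetaProduct_slash_T_zpow]
  have h2 : (γ * ModularGroup.T ^ n) 1 1 = p := by
    rw [Matrix.SpecialLinearGroup.coe_mul, ModularGroup.coe_T_zpow]
    simp [Matrix.mul_apply, Fin.sum_univ_two]
    linarith
  rw [hs, thetaProduct_slash_eigenvalue_of_prime hp2 hS hpS hl h2 h1]

end Eigenvalue

/-! ### Kronecker symbols modulo 24. -/

section Kronecker

lemma kroneckerSymbol_of_odd (a : ℤ) {n : ℤ} (hn : Odd n) :
    kroneckerSymbol a n = (if n < 0 ∧ a < 0 then -1 else 1) * jacobiSym a n.natAbs := by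
  have hn0 : n ≠ 0 := by rintro rfl; simp at hn
  rw [kroneckerSymbol, if_neg hn0]
  congr 1
  conv_rhs => rw [← Nat.prod_primeFactorsList (Int.natAbs_ne_zero.mpr hn0)]
  rw [jacobiSym.list_prod_right fun p hp => (Nat.prime_of_mem_primeFactorsList hp).ne_zero]
  congr 1
  refine List.map_congr_left fun p hp => if_neg ?_
  rintro rfl
  have := Nat.dvd_of_mem_primeFactorsList hp
  have h2 := Nat.odd_iff.mp (Int.natAbs_odd.mpr hn)
  omega

lemma jacobiSym_eq_mod_24 {u : ℤ} (hu : 4 * u.natAbs ∣ 24) {e : ℕ} (he : Odd e) :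
    jacobiSym u e = jacobiSym u (e % 24) := by
  have he' : Odd (e % 24) := he.mod_even (by decide)
  rw [jacobiSym.mod_right u he, jacobiSym.mod_right u he', Nat.mod_mod_of_dvd _ hu]

/-- The Kronecker symbols of the discriminants `-4, -3, -8, -24`, at integers prime to `6`, in terms
of Jacobi symbols modulo a positive integer in the same residue class modulo `24`. -/
lemma kroneckerSymbol_eq_jacobiSym {u w : ℤ} (hu : u ∈ ({-1, -2, -3, -6} : Finset ℤ))
    (hw : w = 1 ∨ w = 2) {d : ℤ} {p : ℕ} (hd : IsCoprime d 6) (hp : (p : ℤ) ≡ d [ZMOD 24]) :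
    kroneckerSymbol (u * w ^ 2) d = jacobiSym u p := by
  have hgcd : Int.gcd d 6 = 1 := Int.isCoprime_iff_gcd_eq_one.mp hd
  have hd2 : d % 2 ≠ 0 := fun h => by
    have : (2 : ℤ) ∣ Int.gcd d 6 := Int.dvd_coe_gcd (Int.dvd_of_emod_eq_zero h) (by norm_num)
    rw [hgcd] at this; norm_num at this
  have hd3 : d % 3 ≠ 0 := fun h => by
    have : (3 : ℤ) ∣ Int.gcd d 6 := Int.dvd_coe_gcd (Int.dvd_of_emod_eq_zero h) (by norm_num)
    rw [hgcd] at this; norm_num at this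
  have hodd : Odd d := Int.odd_iff.mpr (by omega)
  have hmod : (p : ℤ) % 24 = d % 24 := hp
  have hu24 : 4 * u.natAbs ∣ 24 := by fin_cases hu <;> decide
  have hu0 : u < 0 := by fin_cases hu <;> decide
  have hw0 : 0 < w ^ 2 := by rcases hw with rfl | rfl <;> norm_num
  have hsq : jacobiSym (u * w ^ 2) d.natAbs = jacobiSym u d.natAbs := by
    have hwd : w.gcd d.natAbs = 1 := by
      rcases hw with rfl | rfl
      · simp
      · have h2 : Odd d.natAbs := Int.natAbs_odd.mpr hodd
        exact Nat.coprime_two_left.mpr h2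
    rw [jacobiSym.mul_left, jacobiSym.sq_one' hwd, mul_one]
  rw [kroneckerSymbol_of_odd _ hodd, hsq, jacobiSym_eq_mod_24 hu24 (Int.natAbs_odd.mpr hodd),
    jacobiSym_eq_mod_24 hu24 (e := p) (Nat.odd_iff.mpr (by omega))]
  rcases lt_or_ge d 0 with h | h
  -- Here `p ≡ -|d|` modulo 24. As `u < 0`, the character is odd, and its sign change matches the
  -- sign in the Kronecker symbol; this is checked on the residues prime to 6.
  · rw [if_pos ⟨h, mul_neg_of_neg_of_pos hu0 hw0⟩]
    have h1 : p % 24 = 24 - d.natAbs % 24 := by omega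
    have h2 : d.natAbs % 24 < 24 := Nat.mod_lt _ (by norm_num)
    have h3 : d.natAbs % 24 % 2 ≠ 0 := by omega
    have h4 : d.natAbs % 24 % 3 ≠ 0 := by omega
    rw [h1]
    generalize d.natAbs % 24 = r at h2 h3 h4
    fin_cases hu <;> interval_cases r <;> first | omega | norm_num
  · rw [if_neg (by omega), one_mul]
    congr 1
    omega

end Kronecker

/-! ### Boundedness at the cusps. -/

section Bounded

open CongruenceSubgroup

lemma one_le_norm_SL_denom (γ : SL(2, ℤ)) {z : ℍ} (hz : 1 ≤ z.im) :
    1 ≤ ‖(γ 1 0 * z + γ 1 1 : ℂ)‖ := by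
  rcases eq_or_ne (γ 1 0) 0 with hc | hc
  · have hdet : γ 0 0 * γ 1 1 - γ 0 1 * γ 1 0 = 1 := by
      rw [← Matrix.det_fin_two]; exact γ.det_coe
    rw [hc, mul_zero, sub_zero] at hdet
    rcases Int.mul_eq_one_iff_eq_one_or_neg_one.mp hdet with ⟨-, h⟩ | ⟨-, h⟩ <;> simp [hc, h]
  · refine le_trans ?_ (Complex.abs_im_le_norm _)
    have h1 : (1 : ℝ) ≤ |(γ 1 0 : ℝ)| := by exact_mod_cast Int.one_le_abs hc
    simp only [Complex.add_im, Complex.mul_im, Complex.intCast_re, Complex.intCast_im, zero_mul,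
      add_zero, UpperHalfPlane.coe_im]
    rw [abs_mul, abs_of_pos z.im_pos]
    nlinarith

/-- A product of theta functions is holomorphic at the cusps as soon as `Γ₀(N)` acts on it by
scalars of absolute value one. -/
lemma isBoundedAtImInfty_thetaProduct_slash {N k : ℕ} (hN0 : 0 < N) {S : Finset ℕ}
    (hS : ∀ m ∈ S, 0 < m) {l : ℕ → ℕ} (hl : ∑ m ∈ S, l m = 2 * k)
    (h : ∀ γ ∈ Gamma0 N, ∃ s : ℂ, ‖s‖ = 1 ∧
      thetaProduct S l ∣[(k : ℤ)] γ = s • thetaProduct S l) (γ : SL(2, ℤ)) :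
    IsBoundedAtImInfty (thetaProduct S l ∣[(k : ℤ)] γ) := by
  obtain ⟨C, hC, hb⟩ := exists_norm_ramanujanPhi_le
  set B : ℝ := |(γ 1 0 : ℝ)| * (N + 1) + |(γ 1 1 : ℝ)| with hB
  -- With `j = c z + d`, `γ z` has height `y / |j| ^ 2`, so each pair of theta factors is `O(1 + |j|
  -- ^ 2 / y)`. In the strip `|j| ≤ B y`, making this `O(|j|)`, which the weight factor `j ^ (-k)`
  -- cancels.
  have hstrip : ∀ z : ℍ, |z.re| ≤ N → 1 ≤ z.im →
      ‖(thetaProduct S l ∣[(k : ℤ)] γ) z‖ ≤ (2 * C ^ 2 * (1 + B)) ^ k := by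
    intro z hre him
    have hy := z.im_pos
    set j : ℂ := γ 1 0 * z + γ 1 1 with hj
    have hj1 : 1 ≤ ‖j‖ := one_le_norm_SL_denom γ him
    have hjB : ‖j‖ ≤ B * z.im := by
      calc ‖j‖ ≤ ‖(γ 1 0 : ℂ)‖ * ‖(z : ℂ)‖ + ‖(γ 1 1 : ℂ)‖ := by
            rw [← norm_mul]; exact norm_add_le _ _
        _ ≤ |(γ 1 0 : ℝ)| * (N * z.im + z.im) + |(γ 1 1 : ℝ)| * z.im := by
            rw [Complex.norm_intCast, Complex.norm_intCast]
            have h1 : ‖(z : ℂ)‖ ≤ N * z.im + z.im := by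
              refine (Complex.norm_le_abs_re_add_abs_im _).trans ?_
              rw [UpperHalfPlane.coe_re, UpperHalfPlane.coe_im, abs_of_pos hy]
              have : (N : ℝ) ≤ N * z.im := le_mul_of_one_le_right (Nat.cast_nonneg N) him
              linarith
            have h2 := le_mul_of_one_le_right (abs_nonneg (γ 1 1 : ℝ)) him
            have h3 := mul_le_mul_of_nonneg_left h1 (abs_nonneg (γ 1 0 : ℝ))
            linarith
        _ = B * z.im := by rw [hB]; ring
    have himγ : (γ • z).im = z.im / ‖j‖ ^ 2 := by
      rw [ModularGroup.im_smul_eq_div_normSq, Complex.normSq_eq_norm_sq]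
      rfl
    have hpos : 0 < (γ • z).im := (γ • z).im_pos
    have h1 : ‖thetaProduct S l (γ • z)‖ ≤ (C * (1 + 1 / √(γ • z).im)) ^ (2 * k) := by
      rw [thetaProduct, norm_prod, ← hl, ← Finset.prod_pow_eq_pow_sum]
      refine Finset.prod_le_prod (fun _ _ => norm_nonneg _) fun m hm => ?_
      rw [norm_pow]
      have hm1 : (1 : ℝ) ≤ m := by exact_mod_cast hS m hm
      have hmim : ((m : ℂ) * (γ • z : ℍ)).im = m * (γ • z).im := by simp
      have h2 := hb (m * (γ • z : ℍ)) (by rw [hmim]; positivity)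
      rw [hmim] at h2
      refine pow_le_pow_left₀ (norm_nonneg _) (h2.trans ?_) _
      have h3 : √(γ • z).im ≤ √(m * (γ • z).im) :=
        Real.sqrt_le_sqrt (le_mul_of_one_le_left hpos.le hm1)
      have h4 : 0 < √(γ • z).im := Real.sqrt_pos.mpr hpos
      gcongr
    have h2 : (C * (1 + 1 / √(γ • z).im)) ^ 2 ≤ 2 * C ^ 2 * (1 + ‖j‖ ^ 2 / z.im) := by
      have h3 : (1 / √(γ • z).im) ^ 2 = ‖j‖ ^ 2 / z.im := by
        rw [div_pow, Real.sq_sqrt hpos.le, himγ]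
        simp
      rw [mul_pow, ← h3]
      nlinarith [mul_nonneg (sq_nonneg C) (sq_nonneg (1 - 1 / √(γ • z).im))]
    have h5 : ‖j‖ ^ 2 / z.im ≤ B * ‖j‖ := by
      rw [div_le_iff₀ hy]
      nlinarith
    rw [SL_slash_apply', norm_mul, ← hj, zpow_neg, zpow_natCast, norm_inv, norm_pow,
      ← div_eq_mul_inv, div_le_iff₀ (by positivity), ← mul_pow]
    refine h1.trans ?_
    rw [pow_mul]
    refine pow_le_pow_left₀ (by positivity) (h2.trans ?_) _
    have h6 : 1 + ‖j‖ ^ 2 / z.im ≤ (1 + B) * ‖j‖ := by linarith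
    calc 2 * C ^ 2 * (1 + ‖j‖ ^ 2 / z.im) ≤ 2 * C ^ 2 * ((1 + B) * ‖j‖) := by gcongr
      _ = _ := by ring
  -- Since `γ T ^ (N n) γ⁻¹` lies in `Γ₀(N)` and acts by a scalar of modulus one, the norm has
  -- period `N`, and every `z` can be moved into the strip.
  have hper : ∀ (n : ℤ) (z : ℍ), ‖(thetaProduct S l ∣[(k : ℤ)] γ) (ModularGroup.T ^ (N * n) • z)‖ =
      ‖(thetaProduct S l ∣[(k : ℤ)] γ) z‖ := by
    intro n z
    have hmem : γ * ModularGroup.T ^ (N * n) * γ⁻¹ ∈ Gamma0 N := by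
      have h0 : γ⁻¹ 0 0 = γ 1 1 := by rw [Matrix.SpecialLinearGroup.SL2_inv_expl]; rfl
      have h1 : γ⁻¹ 1 0 = -γ 1 0 := by rw [Matrix.SpecialLinearGroup.SL2_inv_expl]; rfl
      rw [Gamma0_mem, Matrix.SpecialLinearGroup.coe_mul, Matrix.SpecialLinearGroup.coe_mul,
        ModularGroup.coe_T_zpow]
      simp only [Matrix.mul_apply, Fin.sum_univ_two, h0, h1]
      simp
      ring
    obtain ⟨s, hs1, hs⟩ := h _ hmem
    have h1 : (thetaProduct S l ∣[(k : ℤ)] γ) ∣[(k : ℤ)] (ModularGroup.T ^ (N * n)) =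
        s • (thetaProduct S l ∣[(k : ℤ)] γ) := by
      rw [← SlashAction.slash_mul, ← ModularForm.SL_smul_slash, ← hs, ← SlashAction.slash_mul]
      congr 1
      group
    have h2 := congrFun h1 z
    rw [SL_slash_apply', ModularGroup.coe_T_zpow] at h2
    simp only [Matrix.of_apply, Matrix.cons_val', Matrix.cons_val_zero, Matrix.cons_val_one,
      Matrix.cons_val_fin_one, Int.cast_zero, Int.cast_one, zero_mul, zero_add, one_zpow, mul_one,
      Pi.smul_apply, smul_eq_mul] at h2
    rw [h2, norm_mul, hs1, one_mul]
  rw [UpperHalfPlane.isBoundedAtImInfty_iff]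
  refine ⟨(2 * C ^ 2 * (1 + B)) ^ k, 1, fun z hz => ?_⟩
  obtain ⟨n, hn⟩ := ModularGroup_T_zpow_mem_verticalStrip z hN0
  rw [← hper n z]
  rw [UpperHalfPlane.mem_verticalStrip_iff] at hn
  exact hstrip _ hn.1 (hz.trans hn.2)

end Bounded

/-! ### Assembly for level 24 and weight 3. -/

section Main

open CongruenceSubgroup

/-- In the applications `u` is the squarefree part of `-∏ m ^ l m`, and `w ^ 2` completes it to a
discriminant. -/
lemma thetaProduct_mem_modularFormsWithChar {l : ℕ → ℕ}
    (hl : ∑ m ∈ Nat.divisors 6, l m = 6) {u w : ℤ} (hu : u ∈ ({-1, -2, -3, -6} : Finset ℤ))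
    (hw : w = 1 ∨ w = 2) (huw : ∀ p : ℕ, IsCoprime (p : ℤ) 6 →
      jacobiSym ((-1) ^ 3 * ∏ m ∈ Nat.divisors 6, (m : ℤ) ^ l m) p = jacobiSym u p) :
    thetaProduct (Nat.divisors 6) l ∈ modularFormsWithChar 24 3 (kroneckerChar (u * w ^ 2)) := by
  have hS : ∀ m ∈ Nat.divisors 6, 0 < m := fun m hm => Nat.pos_of_mem_divisors hm
  have hN : ∀ m ∈ Nat.divisors 6, 4 * m ∣ 24 := fun m hm =>
    Nat.mul_dvd_mul_left 4 (Nat.dvd_of_mem_divisors hm)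
  have hl' : ∑ m ∈ Nat.divisors 6, l m = 2 * 3 := hl
  have htrans : ∀ γ : SL(2, ℤ), γ ∈ Gamma0 24 → IsCoprime (γ 1 1) 6 ∧
      thetaProduct (Nat.divisors 6) l ∣[(3 : ℤ)] γ =
      kroneckerChar (u * w ^ 2) (γ 1 1) • thetaProduct (Nat.divisors 6) l := by
    intro γ hγ
    have hdet : γ 0 0 * γ 1 1 - γ 0 1 * γ 1 0 = 1 := by
      rw [← Matrix.det_fin_two]; exact γ.det_coe
    have hd : IsCoprime (γ 1 1) 6 := by
      obtain ⟨e, he⟩ := (ZMod.intCast_zmod_eq_zero_iff_dvd _ 24).mp (Gamma0_mem.mp hγ)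
      push_cast at he
      exact ⟨γ 0 0, -γ 0 1 * 4 * e, by rw [he] at hdet; linarith⟩
    refine ⟨hd, ?_⟩
    rw [kroneckerChar]
    rcases eq_or_ne (γ 1 0) 0 with hc | hc
    -- With `c = 0` translations do not change `d`, so no prime is available. But `γ = ± T ^ n`, and
    -- `1` and `23` represent `d = ±1` modulo 24; the odd weight gives `-1` in the second case.
    · rw [hc, mul_zero, sub_zero] at hdet
      rcases Int.mul_eq_one_iff_eq_one_or_neg_one.mp hdet with ⟨h0, h1⟩ | ⟨h0, h1⟩
      · have h2 : γ = ModularGroup.T ^ (γ 0 1) := by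
          ext i j
          rw [ModularGroup.coe_T_zpow]
          fin_cases i <;> fin_cases j <;> simp [h0, h1, hc]
        rw [kroneckerSymbol_eq_jacobiSym hu hw (p := 1) hd (by rw [h1]; rfl), h2,
          thetaProduct_slash_T_zpow]
        simp
      · have h2 : γ = -1 * ModularGroup.T ^ (-γ 0 1) := by
          ext i j
          rw [neg_one_mul, Matrix.SpecialLinearGroup.coe_neg, ModularGroup.coe_T_zpow]
          fin_cases i <;> fin_cases j <;> simp [h0, h1, hc]
        have h3 : jacobiSym u 23 = -1 := by fin_cases hu <;> norm_num
        have h4 : thetaProduct (Nat.divisors 6) l ∣[(3 : ℤ)] (-1 : SL(2, ℤ)) =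
            (-1 : ℂ) • thetaProduct (Nat.divisors 6) l := by
          ext z
          rw [SL_slash_apply']
          norm_num
        rw [kroneckerSymbol_eq_jacobiSym hu hw (p := 23) hd (by rw [h1]; rfl), h3, h2,
          SlashAction.slash_mul, h4, ModularForm.SL_smul_slash, thetaProduct_slash_T_zpow]
        simp
    · obtain ⟨p, hp, hpd, h⟩ := exists_prime_thetaProduct_slash (by norm_num) hS hN hl' hγ hc
      have hp6 : IsCoprime (p : ℤ) 6 := by
        obtain ⟨e, he⟩ := hpd.dvd
        obtain ⟨x, y, hxy⟩ := hd
        exact ⟨x, y + x * 4 * e, by push_cast at he; linear_combination hxy - x * he⟩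
      rw [huw p hp6] at h
      rw [kroneckerSymbol_eq_jacobiSym hu hw hd hpd]
      exact h
  refine ⟨mdifferentiable_thetaProduct hS l, fun γ hγ => (htrans γ hγ).2, ?_⟩
  refine isBoundedAtImInfty_thetaProduct_slash (N := 24) (by norm_num) hS hl' fun γ hγ => ?_
  obtain ⟨hd, h⟩ := htrans γ hγ
  refine ⟨_, ?_, h⟩
  -- The residue of `d` modulo 24 is prime to `u`, so the character value is `±1`.
  have hp : ((γ 1 1 % 24).toNat : ℤ) = γ 1 1 % 24 :=
    Int.toNat_of_nonneg (Int.emod_nonneg _ (by norm_num))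
  have hpd : ((γ 1 1 % 24).toNat : ℤ) ≡ γ 1 1 [ZMOD 24] := by rw [hp]; exact Int.mod_modEq _ _
  have hu6 : u ∣ 6 := by fin_cases hu <;> decide
  have hgcd : u.gcd (γ 1 1 % 24).toNat = 1 := by
    rw [← Int.isCoprime_iff_gcd_eq_one]
    obtain ⟨e, he⟩ := hpd.dvd
    obtain ⟨x, y, hxy⟩ := hd
    refine IsCoprime.of_isCoprime_of_dvd_left (IsCoprime.symm ⟨x, y + x * 4 * e, ?_⟩) hu6
    linear_combination hxy - x * he
  rw [kroneckerChar, kroneckerSymbol_eq_jacobiSym hu hw hd hpd]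
  rcases jacobiSym.eq_one_or_neg_one hgcd with h | h <;> simp [h]

lemma jacobiSym_prod_divisors_six (l : ℕ → ℕ) (p : ℕ) :
    jacobiSym ((-1) ^ 3 * ∏ m ∈ Nat.divisors 6, (m : ℤ) ^ l m) p =
      jacobiSym (-1) p * jacobiSym 2 p ^ (l 2 + l 6) * jacobiSym 3 p ^ (l 3 + l 6) := by
  have h1 : ((-1 : ℤ)) ^ 3 * ∏ m ∈ Nat.divisors 6, (m : ℤ) ^ l m =
      -1 * 2 ^ (l 2 + l 6) * 3 ^ (l 3 + l 6) := by
    rw [show Nat.divisors 6 = {1, 2, 3, 6} from rfl]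
    simp only [Finset.mem_insert, Finset.mem_singleton, OfNat.one_ne_ofNat, or_self,
      not_false_eq_true, Finset.prod_insert, Finset.prod_singleton, Nat.reduceEqDiff]
    push_cast
    rw [show (6 : ℤ) = 2 * 3 by norm_num, mul_pow]
    ring
  rw [h1, jacobiSym.mul_left, jacobiSym.mul_left, jacobiSym.pow_left, jacobiSym.pow_left]

end Main

theorem mainTheorem7 (l : ℕ → ℕ) (hl : l 1 + l 2 + l 3 + l 6 = 6) :
    (l 1 + l 3 ≡ 0 [MOD 2] → l 3 + l 6 ≡ 0 [MOD 2] →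
      (fun z : ℍ => ∏ d ∈ Nat.divisors 6, ramanujanPhi (d * z) ^ l d) ∈
        modularFormsWithChar 24 3 (kroneckerChar (-4))) ∧
    (l 1 + l 3 ≡ 0 [MOD 2] → l 3 + l 6 ≡ 1 [MOD 2] →
      (fun z : ℍ => ∏ d ∈ Nat.divisors 6, ramanujanPhi (d * z) ^ l d) ∈
        modularFormsWithChar 24 3 (kroneckerChar (-3))) ∧
    (l 1 + l 3 ≡ 1 [MOD 2] → l 3 + l 6 ≡ 0 [MOD 2] →
      (fun z : ℍ => ∏ d ∈ Nat.divisors 6, ramanujanPhi (d * z) ^ l d) ∈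
        modularFormsWithChar 24 3 (kroneckerChar (-8))) ∧
    (l 1 + l 3 ≡ 1 [MOD 2] → l 3 + l 6 ≡ 1 [MOD 2] →
      (fun z : ℍ => ∏ d ∈ Nat.divisors 6, ramanujanPhi (d * z) ^ l d) ∈
        modularFormsWithChar 24 3 (kroneckerChar (-24))) := by
  have hsum : ∑ m ∈ Nat.divisors 6, l m = 6 := by
    rw [show Nat.divisors 6 = {1, 2, 3, 6} from rfl]
    simpa [add_assoc] using hl
  have hsq : ∀ (a : ℤ) (p : ℕ), a ∣ 6 → IsCoprime (p : ℤ) 6 → jacobiSym a p ^ 2 = 1 := by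
    intro a p ha hp
    exact jacobiSym.sq_one (Int.isCoprime_iff_gcd_eq_one.mp
      (IsCoprime.of_isCoprime_of_dvd_left hp.symm ha))
  have heven : ∀ (a : ℤ) (p n : ℕ), a ∣ 6 → IsCoprime (p : ℤ) 6 → n ≡ 0 [MOD 2] →
      jacobiSym a p ^ n = 1 := by
    intro a p n ha hp hn
    obtain ⟨r, rfl⟩ := (Nat.modEq_zero_iff_dvd).mp hn
    rw [pow_mul, hsq a p ha hp, one_pow]
  have hodd : ∀ (a : ℤ) (p n : ℕ), a ∣ 6 → IsCoprime (p : ℤ) 6 → n ≡ 1 [MOD 2] →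
      jacobiSym a p ^ n = jacobiSym a p := by
    intro a p n ha hp hn
    obtain ⟨r, rfl⟩ := Nat.odd_iff.mpr hn
    rw [pow_succ, pow_mul, hsq a p ha hp, one_pow, one_mul]
  have h2 : (2 : ℤ) ∣ 6 := by norm_num
  have h3 : (3 : ℤ) ∣ 6 := by norm_num
  -- The exponents sum to the even number 6, so `l 2 + l 6`, the exponent of 2 in `∏ m ^ l m`, has
  -- the parity of `l 1 + l 3`.
  have hpar : ∀ i, l 1 + l 3 ≡ i [MOD 2] → l 2 + l 6 ≡ i [MOD 2] := fun i h => by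
    unfold Nat.ModEq at *
    omega
  refine ⟨fun h h' => ?_, fun h h' => ?_, fun h h' => ?_, fun h h' => ?_⟩ <;>
    change thetaProduct (Nat.divisors 6) l ∈ _
  · rw [show (-4 : ℤ) = -1 * 2 ^ 2 by norm_num]
    refine thetaProduct_mem_modularFormsWithChar (u := -1) (w := 2) hsum (by decide) (Or.inr rfl)
      fun p hp => ?_
    rw [jacobiSym_prod_divisors_six, heven 2 p _ h2 hp (hpar 0 h), heven 3 p _ h3 hp h', mul_one,
      mul_one]
  · rw [show (-3 : ℤ) = -3 * 1 ^ 2 by norm_num]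
    refine thetaProduct_mem_modularFormsWithChar (u := -3) (w := 1) hsum (by decide) (Or.inl rfl)
      fun p hp => ?_
    rw [jacobiSym_prod_divisors_six, heven 2 p _ h2 hp (hpar 0 h), hodd 3 p _ h3 hp h', mul_one,
      ← jacobiSym.mul_left]
    norm_num
  · rw [show (-8 : ℤ) = -2 * 2 ^ 2 by norm_num]
    refine thetaProduct_mem_modularFormsWithChar (u := -2) (w := 2) hsum (by decide) (Or.inr rfl)
      fun p hp => ?_
    rw [jacobiSym_prod_divisors_six, hodd 2 p _ h2 hp (hpar 1 h), heven 3 p _ h3 hp h', mul_one,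
      ← jacobiSym.mul_left]
    norm_num
  · rw [show (-24 : ℤ) = -6 * 2 ^ 2 by norm_num]
    refine thetaProduct_mem_modularFormsWithChar (u := -6) (w := 2) hsum (by decide) (Or.inr rfl)
      fun p hp => ?_
    rw [jacobiSym_prod_divisors_six, hodd 2 p _ h2 hp (hpar 1 h), hodd 3 p _ h3 hp h',
      ← jacobiSym.mul_left, ← jacobiSym.mul_left]
    norm_num
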